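/- For a finite simple graph $G$ with $n$ nodes consider the following randomised beeping algorithm of Jeavons et al. in the model $B_{cd}L$ (time is divided into synchronous slots, all nodes start in the same slot; in each slot every node that has not terminated either beeps or listens; a listening node learns whether at least one neighbour beeps, and a beeping node learns whether at least one neighbour beeps too; a terminated node is silent). Every node $v$ keeps a probability $p_v$, initially $1/2$, and executes phases of two slots. - Contending slot: $v$ beeps with probability $p_v$, independently of all other choices. If $v$ beeps and no neighbour beeps, we say that it beeped alone. If a neighbour beeps, $p_v$ is replaced by $p_v/2$; if neither $v$ nor a neighbour beeps, $p_v$ is replaced by $\min(2p_v,1/2)$. - Confirmation slot: exactly the nodes that beeped alone in the contending slot beep; they enter the set $M$ and terminate. Every other non-terminated node that hears a beep in this slot terminates outside $M$. The remaining nodes go on to the next phase. The two-hop version is the same algorithm run with the square $G^2$ in place of $G$ (two distinct nodes are adjacent in $G^2$ if they are adjacent or have a common neighbour in $G$), with phases of three slots: one further slot, reserved for reporting peripheral collisions, lies between the contending and the confirmation slot; in the run on $G^2$, where collision detection already covers distance two, it carries no beeps. There is a function $\varepsilon:\mathbb N\to\mathbb R$ with $\varepsilon(n)=o(1/n)$ such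 that, for every graph $G$ with $n\ge 2$ nodes: 1. with probability at least $1-\varepsilon(n)$, the algorithm terminates at all nodes of $G$, and $M$ is then a maximal independent set of $G$, within fewer than $76\log_2 n$ phases, hence fewer than $152\log_2 n$ slots; 2. with probability at least $1-\varepsilon(n)$, the two-hop version terminates at all nodes, and $M$ is then a two-hop maximal independent set of $G$ (a maximal independent set of $G^2$), within fewer than $76\log_2 n$ phases of three slots each, hence fewer than $228\log_2 n$ slots. -/

import Mathlib

open scoped NNReal ENNReal

/-- A randomised beeping algorithm, run identically by every (anonymous) node of a network in the
model `B_cd L`. In each slot a node that has not halted beeps with probability `beepProb` of its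
current state and listens otherwise. Then `next s beeped heard` is its new state, where `beeped`
says whether it beeped itself and `heard` whether at least one of its neighbours beeped (for a node
that beeps this bit is the collision detection `B_cd`, for a node that listens it is what `L`
provides). A halted node stays silent and keeps its state. -/
structure BeepAlgorithm where
  State : Type
  init : State
  beepProb : State → ℝ≥0
  beepProb_le_one : ∀ s, beepProb s ≤ 1
  next : State → Bool → Bool → State
  halted : State → Bool

open Classical in
/-- The law of a family of independent coins, the coin of `v` being `true` with
probability `p v`. -/
noncomputable def independentCoins {V : Type*} [Fintype V] (p : V → ℝ≥0) (hp : ∀ v, p v ≤ 1) :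
    PMF (V → Bool) :=
  PMF.ofFintype (fun b => ((∏ v, (if b v then p v else 1 - p v) : ℝ≥0) : ℝ≥0∞)) (by
    rw [← ENNReal.ofNNReal_finsetSum]
    have h := Finset.prod_univ_sum (fun _ : V => (Finset.univ : Finset Bool))
      (fun v c => if c then p v else 1 - p v)
    rw [Fintype.piFinset_univ] at h
    rw [← h]
    simp [add_tsub_cancel_of_le (hp _)])

namespace BeepAlgorithm

variable {V : Type*}

/-- `heard G b v`: some neighbour of `v` in `G` beeps, when `b` records who beeps. -/
noncomputable def heard (G : SimpleGraph V) (b : V → Bool) (v : V) : Bool :=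
  open Classical in decide (∃ u, G.Adj v u ∧ b u = true)

/-- The probability with which a node in state `s` beeps in the coming slot. -/
noncomputable def slotProb (A : BeepAlgorithm) (s : A.State) : ℝ≥0 :=
  if A.halted s then 0 else A.beepProb s

theorem slotProb_le_one (A : BeepAlgorithm) (s : A.State) : A.slotProb s ≤ 1 := by
  unfold slotProb
  split
  · exact zero_le_one
  · exact A.beepProb_le_one s

/-- The states of all nodes after a slot in which exactly the nodes `v` with `b v = true` beep. -/
noncomputable def slotUpdate (A : BeepAlgorithm) (G : SimpleGraph V) (σ : V → A.State)
    (b : V → Bool) : V → A.State :=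
  fun v => if A.halted (σ v) then σ v else A.next (σ v) (b v) (heard G b v)

/-- The law of the states of all nodes after `s` slots, in the network with communication
graph `G`, all nodes starting simultaneously in the initial state. -/
noncomputable def run [Fintype V] (A : BeepAlgorithm) (G : SimpleGraph V) :
    ℕ → PMF (V → A.State)
  | 0 => PMF.pure fun _ => A.init
  | s + 1 => (run A G s).bind fun σ =>
      (independentCoins (fun v => A.slotProb (σ v)) fun v => A.slotProb_le_one (σ v)).map
        (A.slotUpdate G σ)

end BeepAlgorithm

/-- The states of a node in the MIS algorithm.
* `contending k`: first slot of a phase, with current beeping probability `p = (1/2) ^ (k + 1)`.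
* `waiting j k won`: a later slot of the phase, with `j` slots to come before the confirmation
  slot; `won` says whether the node beeped alone in the contending slot of this phase, and `k`
  encodes the beeping probability for the next phase.
* `inMIS`, `outMIS`: the node has terminated, inside or outside the MIS. -/
inductive MISState
  | contending (k : ℕ)
  | waiting (j k : ℕ) (won : Bool)
  | inMIS
  | outMIS

/-- Transitions of the MIS algorithm with `r` report slots between the contending slot and the
confirmation slot of each phase. After the contending slot, `p` is doubled (up to `1/2`) if neither
the node nor a neighbour beeped, and halved if a neighbour beeped. -/
def misNext (r : ℕ) : MISState → Bool → Bool → MISState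
  | .contending k, true, false => .waiting r k true
  | .contending k, false, false => .waiting r (k - 1) false
  | .contending k, _, true => .waiting r (k + 1) false
  | .waiting (j + 1) k won, _, _ => .waiting j k won
  | .waiting 0 _ true, _, _ => .inMIS
  | .waiting 0 _ false, _, true => .outMIS
  | .waiting 0 k false, _, false => .contending k
  | .inMIS, _, _ => .inMIS
  | .outMIS, _, _ => .outMIS

/-- In the contending slot a node beeps with its probability `p`, in the confirmation slot exactly
the nodes that beeped alone in the contending slot beep. -/
noncomputable def misBeepProb : MISState → ℝ≥0
  | .contending k => (1 / 2) ^ (k + 1)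
  | .waiting 0 _ true => 1
  | _ => 0

theorem misBeepProb_le_one (s : MISState) : misBeepProb s ≤ 1 := by
  unfold misBeepProb
  split
  · exact pow_le_one₀ zero_le (by rw [div_le_one] <;> norm_num)
  · exact le_rfl
  · exact zero_le_one

def misHalted : MISState → Bool
  | .inMIS => true
  | .outMIS => true
  | _ => false

/-- The MIS beeping algorithm with doubling/halving adaptive probability and initial probability
`1/2`. A phase consists of a contending slot, `r` slots reserved for the reporting of peripheral
collisions, and a confirmation slot, hence of `r + 2` slots. In `B_cd L` on the communication graph
itself no reporting is needed and `r = 0`; the two-hop variant, run in the square of the network,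
has `r = 1`. The report slot carries no beep of the algorithm itself, because a collision within
distance two is already part of the collision detection of the square. -/
noncomputable def misAlgorithm (r : ℕ) : BeepAlgorithm where
  State := MISState
  init := .contending 0
  beepProb := misBeepProb
  beepProb_le_one := misBeepProb_le_one
  next := misNext r
  halted := misHalted

/-- The square of a graph: distinct vertices are adjacent if they are adjacent in `G` or have a
common neighbour in `G`. -/
def squareGraph {V : Type*} (G : SimpleGraph V) : SimpleGraph V where
  Adj u v := u ≠ v ∧ (G.Adj u v ∨ ∃ w, G.Adj u w ∧ G.Adj w v)
  symm := ⟨fun _ _ ⟨hne, h⟩ => ⟨hne.symm, h.elim (fun e => .inl e.symm)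
    fun ⟨w, h1, h2⟩ => .inr ⟨w, h2.symm, h1.symm⟩⟩⟩
  loopless := ⟨fun _ h => h.1 rfl⟩

/-- All nodes have terminated, and the nodes that terminated inside form a maximal independent set
of `G`. -/
def MISComputed {V : Type*} (G : SimpleGraph V) (σ : V → MISState) : Prop :=
  (∀ v, misHalted (σ v) = true) ∧ Maximal G.IsIndepSet {v | σ v = .inMIS}

/-- The probability that the algorithm with `r` report slots per phase, run on the communication
graph `G`, has terminated at every node, with a maximal independent set of `G` as its output, by
the end of slot `s`. -/
noncomputable def misProb {V : Type*} [Fintype V] (r : ℕ) (G : SimpleGraph V) (s : ℕ) : ℝ :=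
  (((misAlgorithm r).run G s).toOuterMeasure {σ | MISComputed G σ}).toReal

/-! Give a contending node with beeping probability `2^{-(k+1)}` the potential `(16/15)^k * √(1 +
D)`, where `D` is the total beeping probability of its neighbours, and a terminated node the
potential 0. In each phase the conditional expectation of this potential contracts by `√(15/16)`.
The reason is a trade-off. If `D` is small, the node mostly hears nothing, so `k` drops, or at `k =
0` it joins the set with conditional probability 1/2. If `D` is large, it mostly hears a beep. Then
either its neighbours rarely have silent neighbourhoods, so their probabilities tend to halve and
`D` shrinks, or they often do, and some neighbour is likely to beep alone and eliminate the node.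
The last point is a correlation inequality, `sum_mul_one_sub_le_coinExp_alone`. Cauchy–Schwarz
(`coinExp_mul_sqrt_le`) separates the node's own factor from the square root, and
`contraction_inequality` closes the estimate in `coinExp_nodePotential_le`. The total potential
starts at no more than `n * √n` and is at least 1 while the output is not yet a finished maximal
independent set, so by Markov's inequality failure after `t` phases has probability at most
`√(15/16)^t * n^(3/2)`. Just under `76 log₂ n` phases make this `O(n^(-3/2))`. Nothing depends on
the graph beyond its order, so the square is covered as well. -/

/-- The numerical inequality behind the contraction of the potential: `D` is the total beeping
probability of the neighbours of a node, `y` the probability that it hears a beep, and `x` the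
average probability that a neighbour would be alone. -/
theorem contraction_inequality {D x y : ℝ} (hx : 0 ≤ x) (hx1 : x ≤ 1) (hy1 : y ≤ 1)
    (hyD : y ≤ D) (hDy : D ≤ y * (1 + D)) (hD : 0 ≤ D) (W : ℝ) (hW0 : 0 ≤ W)
    (hW : W ≤ 16 / 15 * (y * (1 - x)) + 15 / 16 * (1 - y)) :
    W * (W + 16 / 15 * (D * (1 / 2 + 3 / 2 * x))) ≤ 15 / 16 * (1 + D) := by
  -- The left side increases in `W`, so `W` may be replaced by its bound at the worst `y`. That
  -- bound is affine in `y` with slope `16/15 * (1 - x) - 15/16`, whose sign decides between the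
  -- least `y`, `D / (1 + D)`, and the largest, `min D 1`.
  have mono : ∀ Z, W ≤ Z → Z * (Z + 16 / 15 * (D * (1 / 2 + 3 / 2 * x))) ≤ 15 / 16 * (1 + D) →
      W * (W + 16 / 15 * (D * (1 / 2 + 3 / 2 * x))) ≤ 15 / 16 * (1 + D) := by
    intro Z hZ h
    refine le_trans ?_ h
    gcongr
    linarith
  rcases le_total (16 / 15 * (1 - x)) (15 / 16) with hs | hs
  · have h1 : W * (1 + D) ≤ 15 / 16 + 16 / 15 * (1 - x) * D := by
      nlinarith [mul_nonneg (sub_nonneg.2 hs) (sub_nonneg.2 hDy)]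
    refine mono ((15 / 16 + 16 / 15 * (1 - x) * D) / (1 + D)) ?_ ?_
    · rw [le_div_iff₀ (by positivity)]; exact h1
    -- After clearing denominators, `h2`, `h3`, `h4` are the coefficients of `D`, `D^2`, `D^3` in
    -- the difference of the two sides.
    · have h2 : 0 ≤ 5 / 16 + 1 / 2 * x := by positivity
      have h3 : 0 ≤ 45 / 16 - 256 / 225 * ((1 - x) * (3 / 2 + 1 / 2 * x)) - (1 / 2 + 3 / 2 * x) := by
        nlinarith [sq_nonneg (x - 1 / 3)]
      have h4 : 0 ≤ 15 / 16 - 256 / 225 * ((1 - x) * (1 / 2 + 3 / 2 * x)) := by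
        nlinarith [sq_nonneg (x - 1 / 3)]
      have key : (15 / 16 + 16 / 15 * (1 - x) * D) * ((15 / 16 + 16 / 15 * (1 - x) * D)
          + 16 / 15 * (D * (1 / 2 + 3 / 2 * x)) * (1 + D)) ≤ 15 / 16 * (1 + D) ^ 3 := by
        have := mul_nonneg h2 hD
        have := mul_nonneg h3 (pow_nonneg hD 2)
        have := mul_nonneg h4 (pow_nonneg hD 3)
        nlinarith
      have hs' : 0 < 1 + D := by positivity
      calc _ = ((15 / 16 + 16 / 15 * (1 - x) * D) * ((15 / 16 + 16 / 15 * (1 - x) * D)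
          + 16 / 15 * (D * (1 / 2 + 3 / 2 * x)) * (1 + D))) / (1 + D) ^ 2 := by
            field_simp
        _ ≤ _ := by
            rw [div_le_iff₀ (by positivity)]
            linarith
  · rcases le_total D 1 with h | h
    · refine mono (15 / 16 + (16 / 15 * (1 - x) - 15 / 16) * D) (by nlinarith) ?_
      have hc : 0 ≤ D * (1 - D) := mul_nonneg hD (by linarith)
      nlinarith [mul_nonneg hx hD, mul_nonneg hx hc]
    · refine mono (16 / 15 * (1 - x)) (by nlinarith) ?_
      nlinarith [mul_nonneg hx hD, mul_nonneg hx (sub_nonneg.2 h)]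

/-! ### Independent coins and the correlation inequality -/

section Coins
open Classical

variable {V : Type*} [Fintype V]

/-- The expectation of `f` under independent coins with success probabilities `p`. -/
noncomputable def coinExp (p : V → ℝ) (f : (V → Bool) → ℝ) : ℝ :=
  ∑ b : V → Bool, (∏ v, if b v then p v else 1 - p v) * f b

theorem coinExp_prod (p : V → ℝ) (f : V → Bool → ℝ) :
    coinExp p (fun b => ∏ v, f v (b v)) = ∏ v, (p v * f v true + (1 - p v) * f v false) := by
  have h := Finset.prod_univ_sum (fun _ : V => (Finset.univ : Finset Bool))
    (fun v c => (if c then p v else 1 - p v) * f v c)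
  rw [Fintype.piFinset_univ] at h
  simp only [coinExp, ← Finset.prod_mul_distrib]
  rw [← h]
  simp

theorem coinExp_add (p : V → ℝ) (f g : (V → Bool) → ℝ) :
    coinExp p (fun b => f b + g b) = coinExp p f + coinExp p g := by
  simp [coinExp, mul_add, Finset.sum_add_distrib]

theorem coinExp_sub (p : V → ℝ) (f g : (V → Bool) → ℝ) :
    coinExp p (fun b => f b - g b) = coinExp p f - coinExp p g := by
  simp [coinExp, mul_sub, Finset.sum_sub_distrib]

theorem coinExp_const_mul (p : V → ℝ) (c : ℝ) (f : (V → Bool) → ℝ) :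
    coinExp p (fun b => c * f b) = c * coinExp p f := by
  simp only [coinExp, Finset.mul_sum]
  exact Finset.sum_congr rfl fun _ _ => by ring

theorem coinExp_sum {ι : Type*} (p : V → ℝ) (s : Finset ι) (f : ι → (V → Bool) → ℝ) :
    coinExp p (fun b => ∑ i ∈ s, f i b) = ∑ i ∈ s, coinExp p (f i) := by
  simp only [coinExp, Finset.mul_sum]
  exact Finset.sum_comm

theorem coinExp_one (p : V → ℝ) : coinExp p (fun _ => 1) = 1 := by
  simpa using coinExp_prod p (fun _ _ => 1)

variable {p : V → ℝ}

theorem coinWeight_nonneg (hp : ∀ v, 0 ≤ p v ∧ p v ≤ 1) (b : V → Bool) :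
    0 ≤ ∏ v, (if b v then p v else 1 - p v) := by
  refine Finset.prod_nonneg fun v _ => ?_
  split
  · exact (hp v).1
  · linarith [(hp v).2]

theorem coinExp_mono (hp : ∀ v, 0 ≤ p v ∧ p v ≤ 1) {f g : (V → Bool) → ℝ}
    (h : ∀ b, (∀ v, p v = 0 → b v = false) → f b ≤ g b) : coinExp p f ≤ coinExp p g := by
  refine Finset.sum_le_sum fun b _ => ?_
  by_cases hb : ∀ v, p v = 0 → b v = false
  · exact mul_le_mul_of_nonneg_left (h b hb) (coinWeight_nonneg hp b)
  · push Not at hb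
    obtain ⟨v, hv, hbv⟩ := hb
    rw [Finset.prod_eq_zero (Finset.mem_univ v) (by simp [hv, hbv])]
    simp

theorem coinExp_nonneg (hp : ∀ v, 0 ≤ p v ∧ p v ≤ 1) {f : (V → Bool) → ℝ}
    (h : ∀ b, 0 ≤ f b) : 0 ≤ coinExp p f :=
  Finset.sum_nonneg fun b _ => mul_nonneg (coinWeight_nonneg hp b) (h b)

/-- Cauchy–Schwarz for the coin measure reweighted by `f`, applied to `1` and `√g`. -/
theorem coinExp_mul_sqrt_le (hp : ∀ v, 0 ≤ p v ∧ p v ≤ 1) {f g : (V → Bool) → ℝ}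
    (hf : ∀ b, 0 ≤ f b) (hg : ∀ b, 0 ≤ g b) :
    coinExp p (fun b => f b * √(g b)) ≤
      √(coinExp p f) * √(coinExp p fun b => f b * g b) := by
  have h := Real.sum_sqrt_mul_sqrt_le (Finset.univ : Finset (V → Bool))
    (f := fun b => (∏ v, if b v then p v else 1 - p v) * f b)
    (g := fun b => (∏ v, if b v then p v else 1 - p v) * (f b * g b))
    (fun b => mul_nonneg (coinWeight_nonneg hp b) (hf b))
    (fun b => mul_nonneg (coinWeight_nonneg hp b) (mul_nonneg (hf b) (hg b)))
  refine le_trans (le_of_eq ?_) h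
  refine Finset.sum_congr rfl fun b _ => ?_
  have hw := mul_nonneg (coinWeight_nonneg hp b) (hf b)
  rw [← mul_assoc _ (f b) (g b), Real.sqrt_mul hw, ← mul_assoc √_ √_ √_, Real.mul_self_sqrt hw]
  exact (mul_assoc _ _ _).symm

/-- The probability that all nodes of `T` are silent. -/
theorem coinExp_silent (p : V → ℝ) (T : Finset V) :
    coinExp p (fun b => if ∀ u ∈ T, b u = false then 1 else 0) = ∏ u ∈ T, (1 - p u) := by
  have h := coinExp_prod p (fun v c => if v ∈ T → c = false then 1 else 0)
  have h1 : ∀ b : V → Bool, (∏ v, if v ∈ T → b v = false then (1 : ℝ) else 0) =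
      if ∀ u ∈ T, b u = false then 1 else 0 := fun b => by
    rw [Finset.prod_boole]; simp
  simp only [h1] at h
  rw [h, ← Finset.prod_subset (Finset.subset_univ T)]
  · exact Finset.prod_congr rfl fun v hv => by simp [hv]
  · intro v _ hv
    simp [hv]

/-- The probability that `a` beeps while all nodes of `T` are silent. -/
theorem coinExp_beep_silent (p : V → ℝ) {a : V} {T : Finset V} (ha : a ∉ T) :
    coinExp p (fun b => if b a = true ∧ ∀ u ∈ T, b u = false then 1 else 0) =
      p a * ∏ u ∈ T, (1 - p u) := by
  have h : ∀ b : V → Bool, (if b a = true ∧ ∀ u ∈ T, b u = false then (1 : ℝ) else 0) =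
      (if ∀ u ∈ T, b u = false then 1 else 0) -
        (if ∀ u ∈ insert a T, b u = false then 1 else 0) := fun b => by
    by_cases hb : b a <;> by_cases hT : ∀ u ∈ T, b u = false <;> simp [hb, hT]
  simp only [h]
  rw [coinExp_sub, coinExp_silent, coinExp_silent, Finset.prod_insert ha]
  ring

theorem prod_one_sub_nonneg {ι : Type*} {p : ι → ℝ} (hp : ∀ v, 0 ≤ p v ∧ p v ≤ 1)
    (T : Finset ι) :
    0 ≤ ∏ u ∈ T, (1 - p u) :=
  Finset.prod_nonneg fun v _ => by linarith [(hp v).2]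

theorem prod_one_sub_le_one {ι : Type*} {p : ι → ℝ} (hp : ∀ v, 0 ≤ p v ∧ p v ≤ 1)
    (T : Finset ι) :
    ∏ u ∈ T, (1 - p u) ≤ 1 :=
  Finset.prod_le_one (fun v _ => by linarith [(hp v).2]) fun v _ => by linarith [(hp v).1]

theorem one_sub_sum_le_prod_one_sub {ι : Type*} {p : ι → ℝ}
    (hp : ∀ v, 0 ≤ p v ∧ p v ≤ 1) (T : Finset ι) :
    1 - ∑ u ∈ T, p u ≤ ∏ u ∈ T, (1 - p u) := by
  induction T using Finset.induction_on with
  | empty => simp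
  | insert a s ha ih =>
    rw [Finset.prod_insert ha, Finset.sum_insert ha]
    nlinarith [mul_nonneg (hp a).1 (sub_nonneg.2 (prod_one_sub_le_one hp s))]

/-- Adding a coin `a` to a sum `S` preserves the bound because `(1 - a) * (1 + a + S) ≤ 1 + S`. It
forces a beep to be heard with probability at least `D / (1 + D)`. -/
theorem prod_one_sub_mul_le_one {ι : Type*} {p : ι → ℝ}
    (hp : ∀ v, 0 ≤ p v ∧ p v ≤ 1) (T : Finset ι) :
    (∏ u ∈ T, (1 - p u)) * (1 + ∑ u ∈ T, p u) ≤ 1 := by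
  induction T using Finset.induction_on with
  | empty => simp
  | insert a s ha ih =>
    rw [Finset.prod_insert ha, Finset.sum_insert ha]
    have h0 := prod_one_sub_nonneg hp s
    have h1 : 0 ≤ ∑ u ∈ s, p u := Finset.sum_nonneg fun u _ => (hp u).1
    have h2 := hp a
    have h3 : (1 - p a) * (1 + (p a + ∑ u ∈ s, p u)) ≤ 1 + ∑ u ∈ s, p u := by
      nlinarith [mul_nonneg h2.1 h1, mul_nonneg h2.1 h2.1]
    nlinarith [mul_le_mul_of_nonneg_left h3 h0]

theorem prod_mul_prod_le_prod_union {ι : Type*} {p : ι → ℝ}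
    (hp : ∀ v, 0 ≤ p v ∧ p v ≤ 1) (S T : Finset ι) :
    (∏ u ∈ S, (1 - p u)) * ∏ u ∈ T, (1 - p u) ≤ ∏ u ∈ S ∪ T, (1 - p u) := by
  rw [← Finset.prod_union_inter]
  exact mul_le_of_le_one_right (prod_one_sub_nonneg hp _) (prod_one_sub_le_one hp _)

/-- A node of `S` that beeps while its whole neighbourhood `N` is silent exists with probability at
least the probability that `S` is not silent, times the weighted average over `S` of the
probability of a silent neighbourhood. -/
theorem sum_mul_one_sub_le_coinExp_alone (hp : ∀ v, 0 ≤ p v ∧ p v ≤ 1) (N : V → Finset V)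
    (hN : ∀ v, v ∉ N v) (S : Finset V) :
    (∑ u ∈ S, p u * ∏ w ∈ N u, (1 - p w)) * (1 - ∏ u ∈ S, (1 - p u)) ≤
      (∑ u ∈ S, p u) * coinExp p
        (fun b => if ∃ u ∈ S, b u = true ∧ ∀ w ∈ N u, b w = false then 1 else 0) := by
  -- Nodes are added in decreasing order of their silence probability, so the new node `a` lies at
  -- or below the average of the old ones.
  induction S using Finset.induction_on_min_value (fun u => ∏ w ∈ N u, (1 - p w)) with
  | empty => simp
  | insert a s ha hmin ih =>
    rw [Finset.prod_insert ha, Finset.sum_insert ha, Finset.sum_insert ha]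
    set q := fun u => ∏ w ∈ N u, (1 - p w)
    set π := ∏ u ∈ s, (1 - p u) with hπ
    set D := ∑ u ∈ s, p u with hD
    set Q := ∑ u ∈ s, p u * q u with hQ
    set P := coinExp p
        (fun b => if ∃ u ∈ s, b u = true ∧ ∀ w ∈ N u, b w = false then 1 else 0) with hP
    have hq : 0 ≤ q a := prod_one_sub_nonneg hp _
    have hpa := hp a
    have hπ0 : 0 ≤ π := prod_one_sub_nonneg hp _
    have hD0 : 0 ≤ D := Finset.sum_nonneg fun u _ => (hp u).1
    have hπD : π * (1 + D) ≤ 1 := prod_one_sub_mul_le_one hp s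
    have hQD : q a * D ≤ Q := by
      rw [hD, hQ, Finset.mul_sum]
      exact Finset.sum_le_sum fun u hu => by
        rw [mul_comm]; exact mul_le_mul_of_nonneg_left (hmin u hu) (hp u).1
    -- The event that `a` beeps while `N a` and all of `s` are silent is disjoint from the old
    -- event, and silences are positively correlated.
    have hstep : P + p a * q a * π ≤ coinExp p
        (fun b => if ∃ u ∈ insert a s, b u = true ∧ ∀ w ∈ N u, b w = false then 1 else 0) := by
      have h1 : p a * q a * π ≤ coinExp p
          (fun b => if b a = true ∧ ∀ u ∈ N a ∪ s, b u = false then 1 else 0) := by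
        rw [coinExp_beep_silent p (by simp [hN, ha]), mul_assoc]
        exact mul_le_mul_of_nonneg_left (prod_mul_prod_le_prod_union hp _ _) hpa.1
      refine (add_le_add_right h1 P).trans ?_
      rw [hP, ← coinExp_add]
      refine coinExp_mono hp fun b _ => ?_
      by_cases hA : b a = true ∧ ∀ u ∈ N a ∪ s, b u = false
      · have hn : ¬ ∃ u ∈ s, b u = true ∧ ∀ w ∈ N u, b w = false := by
          rintro ⟨u, hu, hbu, _⟩
          simp [hA.2 u (by simp [hu])] at hbu
        have hy : ∃ u ∈ insert a s, b u = true ∧ ∀ w ∈ N u, b w = false :=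
          ⟨a, by simp, hA.1, fun w hw => hA.2 w (by simp [hw])⟩
        rw [if_pos hA, if_neg hn, if_pos hy, zero_add]
      · rw [if_neg hA, add_zero]
        split_ifs with hx hy hy
        · exact le_rfl
        · obtain ⟨u, hu, h⟩ := hx
          exact absurd ⟨u, by simp [hu], h⟩ hy
        · exact zero_le_one
        · exact le_rfl
    refine le_trans ?_ (mul_le_mul_of_nonneg_left hstep (add_nonneg hpa.1 hD0))
    rcases hD0.eq_or_lt with h0 | h0
    · have hz : ∀ u ∈ s, p u = 0 :=
        (Finset.sum_eq_zero_iff_of_nonneg fun u _ => (hp u).1).1 h0.symm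
      have hQ0 : Q = 0 := Finset.sum_eq_zero fun u hu => by rw [hz u hu, zero_mul]
      have hπ1 : π = 1 := Finset.prod_eq_one fun u hu => by rw [hz u hu, sub_zero]
      have hP0 : 0 ≤ P := coinExp_nonneg hp fun b => by split_ifs <;> norm_num
      rw [hQ0, hπ1, ← h0]
      nlinarith [mul_nonneg hpa.1 hP0]
    · have hP' : Q * (1 - π) / D ≤ P := by rw [div_le_iff₀ h0]; linarith
      have hc : q a ≤ Q / D := by rw [le_div_iff₀ h0]; exact hQD
      obtain ⟨c, hcQ⟩ : ∃ c, Q = c * D := ⟨Q / D, by field_simp⟩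
      rw [hcQ, mul_div_cancel_right₀ _ h0.ne'] at hc
      rw [hcQ, mul_right_comm, mul_div_cancel_right₀ _ h0.ne'] at hP'
      rw [hcQ]
      -- With `Q = c * D` and `P` replaced by its lower bound `c * (1 - π)`, the two sides differ by
      -- exactly `p a * (c - q a) * (1 - π * (1 + D))`.
      have e1 := mul_nonneg hpa.1 (mul_nonneg (sub_nonneg.2 hc) (sub_nonneg.2 hπD))
      have e2 := mul_le_mul_of_nonneg_left hP' (add_nonneg hpa.1 hD0)
      nlinarith

end Coins

/-! ### One phase: contraction of a node's potential -/

section Phase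
open Classical

variable {V : Type*} [Fintype V]

/-- The neighbours of `v`, as a finite set. -/
noncomputable def nbrs (G : SimpleGraph V) (v : V) : Finset V := {u | G.Adj v u}

theorem mem_nbrs {G : SimpleGraph V} {u v : V} : u ∈ nbrs G v ↔ G.Adj v u := by
  simp [nbrs]

theorem notMem_nbrs_self (G : SimpleGraph V) (v : V) : v ∉ nbrs G v := by
  simp [mem_nbrs]

theorem heard_eq_false_iff {G : SimpleGraph V} {b : V → Bool} {v : V} :
    BeepAlgorithm.heard G b v = false ↔ ∀ u ∈ nbrs G v, b u = false := by
  simp [BeepAlgorithm.heard, mem_nbrs]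

theorem heard_eq_true_iff {V : Type*} {G : SimpleGraph V} {b : V → Bool} {v : V} :
    BeepAlgorithm.heard G b v = true ↔ ∃ u, G.Adj v u ∧ b u = true := by
  simp [BeepAlgorithm.heard]

/-- The states after a whole phase of the MIS algorithm that begins in `σ` and has the beeps `b` in
its contending slot. -/
noncomputable def afterPhase {V : Type*} (G : SimpleGraph V) (σ : V → MISState) (b : V → Bool)
    (v : V) : MISState :=
  match σ v with
  | .contending k =>
    if BeepAlgorithm.heard G b v then
      if ∃ u, G.Adj v u ∧ b u = true ∧ BeepAlgorithm.heard G b u = false then .outMIS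
      else .contending (k + 1)
    else if b v then .inMIS else .contending (k - 1)
  | s => s

/-- No node is in the middle of a phase. -/
def AtPhaseStart {V : Type*} (σ : V → MISState) : Prop :=
  ∀ v j k w, σ v ≠ .waiting j k w

/-- The beeping probabilities in the states `σ`. -/
noncomputable def beepProbs {V : Type*} (σ : V → MISState) (v : V) : ℝ := misBeepProb (σ v)

theorem beepProbs_mem {V : Type*} (σ : V → MISState) (v : V) :
    0 ≤ beepProbs σ v ∧ beepProbs σ v ≤ 1 :=
  ⟨NNReal.coe_nonneg _, by exact_mod_cast misBeepProb_le_one _⟩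

/-- The contribution of a node's own state to its potential. -/
noncomputable def stateFactor : MISState → ℝ
  | .contending k => (16 / 15) ^ k
  | _ => 0

theorem stateFactor_nonneg (s : MISState) : 0 ≤ stateFactor s := by
  unfold stateFactor
  split
  · positivity
  · exact le_rfl

/-- The potential of a node. It vanishes once the node has terminated. -/
noncomputable def nodePotential (G : SimpleGraph V) (σ : V → MISState) (v : V) : ℝ :=
  stateFactor (σ v) * √(1 + ∑ u ∈ nbrs G v, beepProbs σ u)

theorem nodePotential_nonneg (G : SimpleGraph V) (σ : V → MISState) (v : V) :
    0 ≤ nodePotential G σ v :=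
  mul_nonneg (stateFactor_nonneg _) (Real.sqrt_nonneg _)

/-- Hearing a beep halves the probability or ends in termination. Silence at most doubles it, and
`1/2 + 3/2 = 2`. -/
theorem beepProbs_afterPhase_le (G : SimpleGraph V) {σ : V → MISState} (hσ : AtPhaseStart σ)
    (b : V → Bool) (u : V) :
    beepProbs (afterPhase G σ b) u ≤ beepProbs σ u *
      (1 / 2 + 3 / 2 * if ∀ w ∈ nbrs G u, b w = false then 1 else 0) := by
  simp only [← heard_eq_false_iff]
  cases h : σ u with
  | contending k =>
    by_cases hh : BeepAlgorithm.heard G b u = true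
    · by_cases ha : ∃ w, G.Adj u w ∧ b w = true ∧ BeepAlgorithm.heard G b w = false
      · simp [beepProbs, afterPhase, h, hh, ha, misBeepProb]
      · simp [beepProbs, afterPhase, h, hh, ha, misBeepProb, pow_succ]
    · cases hb : b u
      · rcases k with _ | k
        · norm_num [beepProbs, afterPhase, h, hh, hb, misBeepProb]
        · simp [beepProbs, afterPhase, h, hh, hb, misBeepProb, pow_succ]
          ring_nf
          exact le_rfl
      · simp [beepProbs, afterPhase, h, hh, hb, misBeepProb]
        positivity
  | waiting j k w => exact absurd h (hσ u j k w)
  | inMIS => simp [beepProbs, afterPhase, h, misBeepProb]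
  | outMIS => simp [beepProbs, afterPhase, h, misBeepProb]

/-- The factor by which `stateFactor` changes in a phase, for a node in state `contending k`. -/
noncomputable def phaseFactor (G : SimpleGraph V) (v : V) (k : ℕ) (b : V → Bool) : ℝ :=
  16 / 15 * (1 - (if ∀ u ∈ nbrs G v, b u = false then 1 else 0) -
      if ∃ u ∈ nbrs G v, b u = true ∧ ∀ w ∈ nbrs G u, b w = false then 1 else 0) +
    if k = 0 then (if b v = false ∧ ∀ u ∈ nbrs G v, b u = false then 1 else 0)
    else 15 / 16 * if ∀ u ∈ nbrs G v, b u = false then 1 else 0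

theorem alone_imp_not_silent {G : SimpleGraph V} {v : V} {b : V → Bool}
    (h : ∃ u ∈ nbrs G v, b u = true ∧ ∀ w ∈ nbrs G u, b w = false) :
    ¬ ∀ u ∈ nbrs G v, b u = false := by
  obtain ⟨u, hu, hb, -⟩ := h
  exact fun hs => by simp [hs u hu] at hb

theorem phaseFactor_mem (G : SimpleGraph V) (v : V) (k : ℕ) (b : V → Bool) :
    0 ≤ phaseFactor G v k b ∧ phaseFactor G v k b ≤ 16 / 15 := by
  unfold phaseFactor
  by_cases ha : ∃ u ∈ nbrs G v, b u = true ∧ ∀ w ∈ nbrs G u, b w = false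
  · have hs := alone_imp_not_silent ha
    rw [if_pos ha, if_neg hs,
      if_neg (show ¬ (b v = false ∧ ∀ u ∈ nbrs G v, b u = false) from fun h => hs h.2)]
    split_ifs <;> norm_num
  · rw [if_neg ha]
    by_cases hs : ∀ u ∈ nbrs G v, b u = false
    · rw [if_pos hs]
      split_ifs <;> norm_num
    · rw [if_neg hs,
        if_neg (show ¬ (b v = false ∧ ∀ u ∈ nbrs G v, b u = false) from fun h => hs h.2)]
      split_ifs <;> norm_num

theorem stateFactor_afterPhase_le {G : SimpleGraph V} {σ : V → MISState} {v : V} {k : ℕ}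
    (hv : σ v = .contending k) (b : V → Bool) :
    stateFactor (afterPhase G σ b v) ≤ (16 / 15) ^ k * phaseFactor G v k b := by
  have hpos := mul_nonneg (pow_nonneg (by norm_num : (0 : ℝ) ≤ 16 / 15) k)
    (phaseFactor_mem G v k b).1
  have hiff : (∃ u, G.Adj v u ∧ b u = true ∧ BeepAlgorithm.heard G b u = false) ↔
      ∃ u ∈ nbrs G v, b u = true ∧ ∀ w ∈ nbrs G u, b w = false := by
    simp only [heard_eq_false_iff, mem_nbrs]
  simp only [afterPhase, hv, hiff]
  split_ifs with hh ha hb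
  · exact hpos
  · have hs : ¬ ∀ u ∈ nbrs G v, b u = false := by
      rw [← heard_eq_false_iff, hh]; simp
    simp only [stateFactor, phaseFactor]
    rw [if_neg hs, if_neg ha,
      if_neg (show ¬ (b v = false ∧ ∀ u ∈ nbrs G v, b u = false) from fun h => hs h.2)]
    rw [pow_succ]
    split_ifs <;> simp
  · exact hpos
  · have hs : ∀ u ∈ nbrs G v, b u = false := by
      rw [← heard_eq_false_iff]; simpa using hh
    have hb' : b v = false := by simpa using hb
    simp only [stateFactor, phaseFactor]
    rw [if_pos hs, if_neg (fun h => alone_imp_not_silent h hs),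
      if_pos (show b v = false ∧ ∀ u ∈ nbrs G v, b u = false from ⟨hb', hs⟩)]
    rcases k with _ | k
    · simp
    · simp only [Nat.add_sub_cancel, pow_succ, if_neg (Nat.succ_ne_zero k)]
      ring_nf
      exact le_rfl

/-- At `k = 0` the cap on doubling denies the gain `15/16`, but there the node's own coin is fair
and a beep in a silent neighbourhood puts it into the set. The surviving factor `1/2` is below
`15/16`. -/
theorem coinExp_phaseFactor_le {p : V → ℝ} (hp : ∀ v, 0 ≤ p v ∧ p v ≤ 1) (G : SimpleGraph V)
    {v : V} {k : ℕ} (hv : k = 0 → p v = 1 / 2) :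
    coinExp p (phaseFactor G v k) ≤
      16 / 15 * (1 - ∏ u ∈ nbrs G v, (1 - p u) - coinExp p (fun b =>
        if ∃ u ∈ nbrs G v, b u = true ∧ ∀ w ∈ nbrs G u, b w = false then 1 else 0)) +
      15 / 16 * ∏ u ∈ nbrs G v, (1 - p u) := by
  have hsplit : coinExp p (phaseFactor G v k) =
      16 / 15 * (1 - ∏ u ∈ nbrs G v, (1 - p u) - coinExp p (fun b =>
        if ∃ u ∈ nbrs G v, b u = true ∧ ∀ w ∈ nbrs G u, b w = false then 1 else 0)) +
      coinExp p (fun b =>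
        if k = 0 then (if b v = false ∧ ∀ u ∈ nbrs G v, b u = false then 1 else 0)
        else 15 / 16 * if ∀ u ∈ nbrs G v, b u = false then 1 else 0) := by
    unfold phaseFactor
    rw [coinExp_add, coinExp_const_mul, coinExp_sub, coinExp_sub, coinExp_one, coinExp_silent]
  rw [hsplit]
  refine add_le_add_right ?_ _
  have hq := prod_one_sub_nonneg hp (nbrs G v)
  split_ifs with hk
  · have h := coinExp_silent p (insert v (nbrs G v))
    simp only [Finset.forall_mem_insert] at h
    rw [h, Finset.prod_insert (notMem_nbrs_self G v), hv hk]
    linarith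
  · rw [coinExp_const_mul, coinExp_silent]

/-- In every phase the expected potential of a node shrinks by a constant factor. -/
theorem coinExp_nodePotential_le (G : SimpleGraph V) {σ : V → MISState} (hσ : AtPhaseStart σ)
    (v : V) :
    coinExp (beepProbs σ) (fun b => nodePotential G (afterPhase G σ b) v) ≤
      √(15 / 16) * nodePotential G σ v := by
  have hp := beepProbs_mem σ
  by_cases hc : ∃ k, σ v = .contending k
  swap
  · have h0 : stateFactor (σ v) = 0 := by
      unfold stateFactor
      split
      · exact absurd ⟨_, ‹_›⟩ hc
      · rfl
    have h1 : ∀ b, afterPhase G σ b v = σ v := fun b => by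
      unfold afterPhase
      split
      · exact absurd ⟨_, ‹_›⟩ hc
      · rfl
    simp only [nodePotential, h1, h0, zero_mul, mul_zero]
    simp [coinExp]
  obtain ⟨k, hk⟩ := hc
  set p := beepProbs σ with hpdef
  set D := ∑ u ∈ nbrs G v, p u with hD
  set Q := ∑ u ∈ nbrs G v, p u * ∏ w ∈ nbrs G u, (1 - p w) with hQ
  set q := ∏ u ∈ nbrs G v, (1 - p u) with hq
  set W := coinExp p (phaseFactor G v k) with hW
  set R := coinExp p (fun b =>
        if ∃ u ∈ nbrs G v, b u = true ∧ ∀ w ∈ nbrs G u, b w = false then 1 else 0) with hR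
  have hWle : W ≤ 16 / 15 * (1 - q - R) + 15 / 16 * q :=
    coinExp_phaseFactor_le hp G fun h0 => by
      rw [hpdef, beepProbs, hk, h0]; simp [misBeepProb]
  have hW0 : 0 ≤ W := coinExp_nonneg hp fun b => (phaseFactor_mem G v k b).1
  have hR0 : 0 ≤ R := coinExp_nonneg hp fun b => by split_ifs <;> norm_num
  have hRQ : Q * (1 - q) ≤ D * R :=
    sum_mul_one_sub_le_coinExp_alone hp (nbrs G) (notMem_nbrs_self G) (nbrs G v)
  have hD0 : 0 ≤ D := Finset.sum_nonneg fun u _ => (hp u).1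
  have hQ0 : 0 ≤ Q := Finset.sum_nonneg fun u _ => mul_nonneg (hp u).1 (prod_one_sub_nonneg hp _)
  have hQD : Q ≤ D := Finset.sum_le_sum fun u _ =>
    mul_le_of_le_one_right (hp u).1 (prod_one_sub_le_one hp _)
  have hq0 : 0 ≤ q := prod_one_sub_nonneg hp _
  have hqD : q * (1 + D) ≤ 1 := prod_one_sub_mul_le_one hp _
  have hDq : 1 - D ≤ q := one_sub_sum_le_prod_one_sub hp _
  have hA : (0 : ℝ) ≤ (16 / 15) ^ k := by positivity
  -- `g` bounds the quantity under the root after the phase.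
  set g : (V → Bool) → ℝ := fun b => 1 + ∑ u ∈ nbrs G v, p u *
    (1 / 2 + 3 / 2 * if ∀ w ∈ nbrs G u, b w = false then 1 else 0) with hg
  have hg1 : ∀ b, 0 ≤ g b - 1 := fun b => by
    simp only [hg, add_sub_cancel_left]
    exact Finset.sum_nonneg fun u _ => mul_nonneg (hp u).1 (by split_ifs <;> norm_num)
  have hEg : coinExp p (fun b => g b - 1) = 1 / 2 * D + 3 / 2 * Q := by
    simp only [hg, add_sub_cancel_left]
    rw [coinExp_sum, hD, hQ, Finset.mul_sum, Finset.mul_sum, ← Finset.sum_add_distrib]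
    refine Finset.sum_congr rfl fun u _ => ?_
    have h1 := coinExp_const_mul p (1 / 2) (fun _ => (1 : ℝ))
    simp only [mul_one, coinExp_one] at h1
    rw [coinExp_const_mul, coinExp_add, coinExp_const_mul, coinExp_silent, h1]
    ring
  -- Writing `g = 1 + (g - 1)` and bounding the factor by `16/15` only on `g - 1` avoids any
  -- analysis of their dependence.
  have hfg : coinExp p (fun b => phaseFactor G v k b * g b) ≤
      W + 16 / 15 * (1 / 2 * D + 3 / 2 * Q) := by
    rw [hW, ← hEg, ← coinExp_const_mul, ← coinExp_add]
    refine coinExp_mono hp fun b _ => ?_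
    nlinarith [mul_le_mul_of_nonneg_right (phaseFactor_mem G v k b).2 (hg1 b)]
  have hpoly : W * (W + 16 / 15 * (1 / 2 * D + 3 / 2 * Q)) ≤ 15 / 16 * (1 + D) := by
    -- `x = Q / D` is the weighted average silence probability. It is set to 0 when no neighbour can
    -- beep.
    obtain ⟨x, hx0, hx1, hx, hxR⟩ : ∃ x, 0 ≤ x ∧ x ≤ 1 ∧ Q = x * D ∧ x * (1 - q) ≤ R := by
      rcases hD0.eq_or_lt with h0 | h0
      · exact ⟨0, le_rfl, zero_le_one, by linarith, by linarith⟩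
      · refine ⟨Q / D, by positivity, (div_le_one h0).2 hQD, by field_simp, ?_⟩
        rw [div_mul_eq_mul_div, div_le_iff₀ h0]
        linarith
    have h := contraction_inequality (D := D) (x := x) (y := 1 - q) hx0 hx1 (by linarith)
      (by linarith) (by linarith) hD0 W hW0 (by linarith)
    rw [hx]
    linarith
  calc coinExp p (fun b => nodePotential G (afterPhase G σ b) v)
      ≤ coinExp p (fun b => (16 / 15) ^ k * (phaseFactor G v k b * √(g b))) := by
        refine coinExp_mono hp fun b _ => ?_
        rw [← mul_assoc]
        refine mul_le_mul (stateFactor_afterPhase_le hk b) (Real.sqrt_le_sqrt ?_)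
          (Real.sqrt_nonneg _) (mul_nonneg hA (phaseFactor_mem G v k b).1)
        exact add_le_add_right (Finset.sum_le_sum fun u _ => beepProbs_afterPhase_le G hσ b u) 1
    _ ≤ (16 / 15) ^ k * (√W * √(W + 16 / 15 * (1 / 2 * D + 3 / 2 * Q))) := by
        rw [coinExp_const_mul]
        refine mul_le_mul_of_nonneg_left ?_ hA
        refine (coinExp_mul_sqrt_le hp (fun b => (phaseFactor_mem G v k b).1)
          fun b => by linarith [hg1 b]).trans ?_
        exact mul_le_mul_of_nonneg_left (Real.sqrt_le_sqrt hfg) (Real.sqrt_nonneg _)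
    _ ≤ (16 / 15) ^ k * √(15 / 16 * (1 + D)) := by
        rw [← Real.sqrt_mul hW0]
        exact mul_le_mul_of_nonneg_left (Real.sqrt_le_sqrt hpoly) hA
    _ = √(15 / 16) * nodePotential G σ v := by
        rw [nodePotential, hk, Real.sqrt_mul (by norm_num), stateFactor]
        ring

end Phase

/-! ### Expectations along a run -/

section Expectation

theorem PMF.tsum_bind_mul {α β : Type*} (p : PMF α) (k : α → PMF β) (f : β → ℝ≥0∞) :
    ∑' b, p.bind k b * f b = ∑' a, p a * ∑' b, k a b * f b := by
  simp only [PMF.bind_apply, ← ENNReal.tsum_mul_right, ← ENNReal.tsum_mul_left]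
  rw [ENNReal.tsum_comm]
  simp only [mul_assoc]

theorem PMF.tsum_pure_mul {α : Type*} (a : α) (f : α → ℝ≥0∞) :
    ∑' b, PMF.pure a b * f b = f a := by
  rw [tsum_eq_single a fun b hb => by simp [PMF.pure_apply, hb]]
  simp

theorem PMF.tsum_map_mul {α β : Type*} (p : PMF α) (g : α → β) (f : β → ℝ≥0∞) :
    ∑' b, p.map g b * f b = ∑' a, p a * f (g a) := by
  simp only [PMF.map, PMF.tsum_bind_mul, Function.comp, PMF.tsum_pure_mul]

namespace BeepAlgorithm

variable {V : Type*} [Fintype V]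

/-- The expectation of `f` after one slot that begins with the states `σ`. -/
noncomputable def slotExp (A : BeepAlgorithm) (G : SimpleGraph V) (f : (V → A.State) → ℝ≥0∞)
    (σ : V → A.State) : ℝ≥0∞ :=
  ∑' b, independentCoins (fun v => A.slotProb (σ v)) (fun v => A.slotProb_le_one (σ v)) b *
    f (A.slotUpdate G σ b)

/-- The Markov property in dual form: the last `m` slots act backwards on the observable. -/
theorem tsum_run_add (A : BeepAlgorithm) (G : SimpleGraph V) (s m : ℕ)
    (f : (V → A.State) → ℝ≥0∞) :
    ∑' σ, A.run G (s + m) σ * f σ = ∑' σ, A.run G s σ * (A.slotExp G)^[m] f σ := by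
  induction m generalizing f with
  | zero => rfl
  | succ m ih =>
    rw [Function.iterate_succ_apply, ← ih, ← add_assoc]
    simp only [run, PMF.tsum_bind_mul, PMF.tsum_map_mul, slotExp]

theorem slotExp_of_deterministic (A : BeepAlgorithm) (G : SimpleGraph V)
    (f : (V → A.State) → ℝ≥0∞) (σ : V → A.State) (b : V → Bool)
    (h : ∀ v, A.slotProb (σ v) = if b v then 1 else 0) :
    A.slotExp G f σ = f (A.slotUpdate G σ b) := by
  unfold slotExp
  have hc : ∀ b', independentCoins (fun v => A.slotProb (σ v))
      (fun v => A.slotProb_le_one (σ v)) b' =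
        ((∏ v, (if b' v then A.slotProb (σ v) else 1 - A.slotProb (σ v)) : ℝ≥0) : ℝ≥0∞) :=
    fun _ => rfl
  rw [tsum_eq_single b]
  · rw [hc, Finset.prod_eq_one, ENNReal.coe_one, one_mul]
    intro v _
    rw [h]
    cases b v <;> simp
  · intro b' hb'
    obtain ⟨v, hv⟩ := Function.ne_iff.1 hb'
    rw [hc, Finset.prod_eq_zero (Finset.mem_univ v), ENNReal.coe_zero, zero_mul]
    rw [h]
    cases h1 : b v <;> cases h2 : b' v <;> simp_all

/-- Beep patterns in which a node of probability 0 beeps have weight zero, so `f` need only be known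
on the others. This matters because such patterns could break the phase invariant. -/
theorem slotExp_eq_coinExp (A : BeepAlgorithm) (G : SimpleGraph V)
    (σ : V → A.State) {f : (V → A.State) → ℝ≥0∞} {g : (V → Bool) → ℝ} (hg : ∀ b, 0 ≤ g b)
    (hf : ∀ b, (∀ v, A.slotProb (σ v) = 0 → b v = false) →
      f (A.slotUpdate G σ b) = ENNReal.ofReal (g b)) :
    A.slotExp G f σ = ENNReal.ofReal (coinExp (fun v => (A.slotProb (σ v) : ℝ)) g) := by
  classical
  have hp : ∀ v, 0 ≤ (A.slotProb (σ v) : ℝ) ∧ (A.slotProb (σ v) : ℝ) ≤ 1 := fun v =>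
    ⟨NNReal.coe_nonneg _, by exact_mod_cast A.slotProb_le_one _⟩
  have hc : ∀ b', independentCoins (fun v => A.slotProb (σ v))
      (fun v => A.slotProb_le_one (σ v)) b' =
        ((∏ v, (if b' v then A.slotProb (σ v) else 1 - A.slotProb (σ v)) : ℝ≥0) : ℝ≥0∞) :=
    fun _ => rfl
  unfold slotExp coinExp
  rw [tsum_fintype, ENNReal.ofReal_sum_of_nonneg
    fun b _ => mul_nonneg (coinWeight_nonneg hp b) (hg b)]
  refine Finset.sum_congr (by congr!) fun b _ => ?_
  rw [ENNReal.ofReal_mul (coinWeight_nonneg hp b), hc]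
  have hw : ENNReal.ofReal (∏ v, if b v then (A.slotProb (σ v) : ℝ) else 1 - A.slotProb (σ v)) =
      ((∏ v, (if b v then A.slotProb (σ v) else 1 - A.slotProb (σ v)) : ℝ≥0) : ℝ≥0∞) := by
    rw [← ENNReal.ofReal_coe_nnreal, NNReal.coe_prod]
    congr 1
    refine Finset.prod_congr rfl fun v _ => ?_
    split
    · rfl
    · rw [NNReal.coe_sub (A.slotProb_le_one _), NNReal.coe_one]
  rw [hw]
  by_cases hb : ∀ v, A.slotProb (σ v) = 0 → b v = false
  · rw [hf b hb]
  · push Not at hb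
    obtain ⟨v, hv, hbv⟩ := hb
    rw [Finset.prod_eq_zero (Finset.mem_univ v) (by simp [hv, hbv])]
    simp

end BeepAlgorithm

end Expectation

/-! ### Slots collapsed into phases -/

section PhaseRun
open BeepAlgorithm

variable {V : Type*}

theorem misAlgorithm_slotProb (r : ℕ) (s : MISState) :
    (misAlgorithm r).slotProb s = misBeepProb s := by
  cases s <;> simp [slotProb, misAlgorithm, misHalted, misBeepProb]

/-- `BeepAlgorithm.slotUpdate` for the MIS algorithm. -/
noncomputable def misSlotUpdate (r : ℕ) (G : SimpleGraph V) (σ : V → MISState) (b : V → Bool) :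
    V → MISState :=
  fun v => if misHalted (σ v) then σ v else misNext r (σ v) (b v) (heard G b v)

/-- `BeepAlgorithm.slotExp` for the MIS algorithm. -/
noncomputable def misSlotExp [Fintype V] (r : ℕ) (G : SimpleGraph V)
    (f : (V → MISState) → ℝ≥0∞) (σ : V → MISState) : ℝ≥0∞ :=
  (misAlgorithm r).slotExp G f σ

/-- `BeepAlgorithm.run` for the MIS algorithm. -/
noncomputable def misRun [Fintype V] (r : ℕ) (G : SimpleGraph V) (s : ℕ) : PMF (V → MISState) :=
  (misAlgorithm r).run G s

theorem tsum_misRun_add [Fintype V] (r : ℕ) (G : SimpleGraph V) (s m : ℕ)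
    (f : (V → MISState) → ℝ≥0∞) :
    ∑' σ, misRun r G (s + m) σ * f σ = ∑' σ, misRun r G s σ * (misSlotExp r G)^[m] f σ :=
  (misAlgorithm r).tsum_run_add G s m f

theorem misSlotExp_of_deterministic [Fintype V] (r : ℕ) (G : SimpleGraph V)
    (f : (V → MISState) → ℝ≥0∞) (σ : V → MISState) (b : V → Bool)
    (h : ∀ v, misBeepProb (σ v) = if b v then 1 else 0) :
    misSlotExp r G f σ = f (misSlotUpdate r G σ b) :=
  (misAlgorithm r).slotExp_of_deterministic G f σ b fun v =>
    (misAlgorithm_slotProb r _).trans (h v)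

/-- The states after the contending slot of a phase that begins in `σ` and has the beeps `b` in
its contending slot, when `j` slots are to come before the confirmation slot. -/
noncomputable def midPhase (G : SimpleGraph V) (σ : V → MISState) (b : V → Bool) (j : ℕ)
    (v : V) : MISState :=
  match σ v with
  | .contending k => if heard G b v then .waiting j (k + 1) false
      else if b v then .waiting j k true else .waiting j (k - 1) false
  | s => s

theorem slotUpdate_eq_midPhase (r : ℕ) (G : SimpleGraph V) {σ : V → MISState}
    (hσ : AtPhaseStart σ) (b : V → Bool) :
    misSlotUpdate r G σ b = midPhase G σ b r := by
  funext v
  unfold misSlotUpdate midPhase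
  cases h : σ v with
  | contending k =>
    cases hh : heard G b v <;> cases hb : b v <;> simp [misHalted, misNext]
  | waiting j k w => exact absurd h (hσ v j k w)
  | inMIS => simp [misHalted]
  | outMIS => simp [misHalted]

/-- Only nodes that contend beep. -/
def BeepsAllowed (σ : V → MISState) (b : V → Bool) : Prop :=
  ∀ v, misBeepProb (σ v) = 0 → b v = false

theorem BeepsAllowed.contending {σ : V → MISState} (hσ : AtPhaseStart σ) {b : V → Bool}
    (hb : BeepsAllowed σ b) {v : V} (hv : b v = true) : ∃ k, σ v = .contending k := by
  cases h : σ v with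
  | contending k => exact ⟨k, rfl⟩
  | waiting j k w => exact absurd h (hσ v j k w)
  | inMIS => exact absurd (hb v (by simp [h, misBeepProb])) (by simp [hv])
  | outMIS => exact absurd (hb v (by simp [h, misBeepProb])) (by simp [hv])

variable [Fintype V]

theorem slotExp_midPhase_succ (r : ℕ) (G : SimpleGraph V) {σ : V → MISState}
    (hσ : AtPhaseStart σ) (b : V → Bool) (j : ℕ) (f : (V → MISState) → ℝ≥0∞) :
    misSlotExp r G f (midPhase G σ b (j + 1)) = f (midPhase G σ b j) := by
  rw [misSlotExp_of_deterministic _ _ _ _ (fun _ => false)]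
  · congr 1
    funext v
    unfold misSlotUpdate midPhase
    cases h : σ v with
    | contending k =>
      cases hh : heard G b v <;> cases hb : b v <;> simp [misHalted, misNext]
    | waiting j k w => exact absurd h (hσ v j k w)
    | inMIS => simp [misHalted]
    | outMIS => simp [misHalted]
  · intro v
    unfold midPhase
    cases h : σ v with
    | contending k => cases hh : heard G b v <;> cases hb : b v <;> simp [misBeepProb]
    | waiting j k w => exact absurd h (hσ v j k w)
    | inMIS => simp [misBeepProb]
    | outMIS => simp [misBeepProb]

theorem slotExp_midPhase_zero (r : ℕ) (G : SimpleGraph V) {σ : V → MISState}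
    (hσ : AtPhaseStart σ) {b : V → Bool} (hb : BeepsAllowed σ b) (f : (V → MISState) → ℝ≥0∞) :
    misSlotExp r G f (midPhase G σ b 0) = f (afterPhase G σ b) := by
  -- The confirmation slot involves no randomness: its beepers are those that beeped alone. `hb`
  -- excludes terminated nodes from them.
  rw [misSlotExp_of_deterministic _ _ _ _ (fun v => b v && !heard G b v)]
  · congr 1
    funext v
    have hbeep : heard G (fun v => b v && !heard G b v) v = true ↔
        ∃ u, G.Adj v u ∧ b u = true ∧ heard G b u = false := by
      simp [heard_eq_true_iff]
    unfold misSlotUpdate midPhase afterPhase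
    cases h : σ v with
    | contending k =>
      cases hh : heard G b v
      · have hno : ¬ ∃ u, G.Adj v u ∧ b u = true ∧ heard G b u = false := by
          rintro ⟨u, hu, hbu, -⟩
          rw [heard_eq_true_iff.2 ⟨u, hu, hbu⟩] at hh
          simp at hh
        rw [← hbeep, Bool.not_eq_true] at hno
        cases hbv : b v <;> simp [misHalted, misNext, hno]
      · by_cases ha : ∃ u, G.Adj v u ∧ b u = true ∧ heard G b u = false
        · have ha' := hbeep.2 ha
          simp only [if_pos ha]
          simp [misHalted, misNext, ha']
        · have ha' := ha
          rw [← hbeep, Bool.not_eq_true] at ha'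
          simp only [if_neg ha]
          simp [misHalted, misNext, ha']
    | waiting j k w => exact absurd h (hσ v j k w)
    | inMIS => simp [misHalted]
    | outMIS => simp [misHalted]
  · intro v
    unfold midPhase
    cases h : σ v with
    | contending k => cases hh : heard G b v <;> cases hb : b v <;> simp [misBeepProb]
    | waiting j k w => exact absurd h (hσ v j k w)
    | inMIS => rw [hb v (by simp [h, misBeepProb])]; simp [misBeepProb]
    | outMIS => rw [hb v (by simp [h, misBeepProb])]; simp [misBeepProb]

theorem slotExp_iterate_midPhase (r : ℕ) (G : SimpleGraph V) {σ : V → MISState}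
    (hσ : AtPhaseStart σ) {b : V → Bool} (hb : BeepsAllowed σ b) (j : ℕ)
    (f : (V → MISState) → ℝ≥0∞) :
    (misSlotExp r G)^[j + 1] f (midPhase G σ b j) = f (afterPhase G σ b) := by
  induction j with
  | zero => exact slotExp_midPhase_zero r G hσ hb f
  | succ j ih =>
    rw [Function.iterate_succ_apply']
    exact (slotExp_midPhase_succ r G hσ b j _).trans ih

/-- The expectation of `f` after one phase. -/
theorem slotExp_iterate_phase (r : ℕ) (G : SimpleGraph V) {σ : V → MISState}
    (hσ : AtPhaseStart σ) {f : (V → MISState) → ℝ≥0∞} {g : (V → Bool) → ℝ} (hg : ∀ b, 0 ≤ g b)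
    (hf : ∀ b, BeepsAllowed σ b → f (afterPhase G σ b) = ENNReal.ofReal (g b)) :
    (misSlotExp r G)^[r + 2] f σ = ENNReal.ofReal (coinExp (beepProbs σ) g) := by
  have hprob : (fun v => ((misAlgorithm r).slotProb (σ v) : ℝ)) = beepProbs σ :=
    funext fun v => by rw [misAlgorithm_slotProb]; rfl
  -- The outermost application is the contending slot, the only random one. The other `r + 1` slots
  -- are deterministic.
  rw [Function.iterate_succ_apply', ← hprob]
  refine (misAlgorithm r).slotExp_eq_coinExp G σ hg fun b hb => ?_
  have hb' : BeepsAllowed σ b := fun v hv => hb v ((misAlgorithm_slotProb r _).trans hv)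
  rw [← hf b hb']
  refine Eq.trans ?_ (slotExp_iterate_midPhase r G hσ hb' r f)
  rw [← slotUpdate_eq_midPhase r G hσ]
  rfl

end PhaseRun

/-! ### Invariant, total potential and Markov's inequality -/

section Potential
open BeepAlgorithm

variable {V : Type*}

/-- The invariant of the MIS algorithm at the beginning of a phase. -/
structure Consistent (G : SimpleGraph V) (σ : V → MISState) : Prop where
  atPhaseStart : AtPhaseStart σ
  out_of_adj : ∀ u v, G.Adj u v → σ u = .inMIS → σ v = .outMIS
  exists_adj : ∀ v, σ v = .outMIS → ∃ u, G.Adj v u ∧ σ u = .inMIS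

theorem consistent_init (G : SimpleGraph V) : Consistent G fun _ => .contending 0 :=
  ⟨fun _ _ _ _ => by simp, fun _ _ _ h => by simp at h, fun _ h => by simp at h⟩

theorem afterPhase_eq_inMIS_iff {G : SimpleGraph V} {σ : V → MISState} {b : V → Bool} {v : V} :
    afterPhase G σ b v = .inMIS ↔
      σ v = .inMIS ∨ (∃ k, σ v = .contending k) ∧ b v = true ∧ heard G b v = false := by
  unfold afterPhase
  cases h : σ v with
  | contending k => cases hh : heard G b v <;> cases hb : b v <;> simp <;> split_ifs <;> simp
  | _ => simp

theorem afterPhase_eq_outMIS_iff {G : SimpleGraph V} {σ : V → MISState} {b : V → Bool} {v : V} :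
    afterPhase G σ b v = .outMIS ↔
      σ v = .outMIS ∨ (∃ k, σ v = .contending k) ∧
        ∃ u, G.Adj v u ∧ b u = true ∧ heard G b u = false := by
  unfold afterPhase
  cases h : σ v with
  | contending k =>
    by_cases ha : ∃ u, G.Adj v u ∧ b u = true ∧ heard G b u = false
    · have hh : heard G b v = true := by
        obtain ⟨u, hu, hbu, -⟩ := ha
        exact heard_eq_true_iff.2 ⟨u, hu, hbu⟩
      simp only [if_pos ha, hh]
      simp [ha]
    · simp only [if_neg ha]
      split_ifs <;> simpa using ha
  | _ => simp

/-- A node that joins has beeped alone, so each contending neighbour hears its confirmation and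
leaves. A neighbour already inside would have expelled it before. Conversely, a node leaves only
because of a lone beeper, which must be contending and therefore joins. -/
theorem Consistent.afterPhase {G : SimpleGraph V} {σ : V → MISState} (h : Consistent G σ)
    {b : V → Bool} (hb : BeepsAllowed σ b) : Consistent G (afterPhase G σ b) where
  atPhaseStart v j k w hv := by
    unfold _root_.afterPhase at hv
    cases hs : σ v with
    | contending k => simp only [hs] at hv; split_ifs at hv
    | waiting j k w => exact h.atPhaseStart v j k w hs
    | _ => simp [hs] at hv
  out_of_adj u v huv hu := by
    rw [afterPhase_eq_inMIS_iff] at hu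
    rw [afterPhase_eq_outMIS_iff]
    rcases hu with hu | ⟨⟨k, hk⟩, hbu, hhu⟩
    · exact .inl (h.out_of_adj u v huv hu)
    · cases hv : σ v with
      | contending k => exact .inr ⟨⟨k, rfl⟩, u, huv.symm, hbu, hhu⟩
      | waiting j k w => exact absurd hv (h.atPhaseStart v j k w)
      | inMIS => exact absurd (h.out_of_adj v u huv.symm hv) (by simp [hk])
      | outMIS => exact .inl rfl
  exists_adj v hv := by
    simp only [afterPhase_eq_inMIS_iff]
    rw [afterPhase_eq_outMIS_iff] at hv
    rcases hv with hv | ⟨-, u, hu, hbu, hhu⟩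
    · obtain ⟨u, hu, hu'⟩ := h.exists_adj v hv
      exact ⟨u, hu, .inl hu'⟩
    · exact ⟨u, hu, .inr ⟨hb.contending h.atPhaseStart hbu, hbu, hhu⟩⟩

theorem Consistent.misComputed {G : SimpleGraph V} {σ : V → MISState} (h : Consistent G σ)
    (hh : ∀ v, misHalted (σ v) = true) : MISComputed G σ := by
  refine ⟨hh, ?_, ?_⟩
  · intro u hu v hv _ huv
    exact absurd ((h.out_of_adj u v huv hu).symm.trans hv) (by simp)
  · intro S hS hle v hv
    have hvh := hh v
    cases hs : σ v with
    | inMIS => exact hs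
    | outMIS =>
      obtain ⟨u, hu, hu'⟩ := h.exists_adj v hs
      exact absurd hu (hS hv (hle hu') hu.ne)
    | _ => simp [hs, misHalted] at hvh

variable [Fintype V]

open Classical in
/-- The total potential; infinite for states that do not occur at the beginning of a phase. -/
noncomputable def potential (G : SimpleGraph V) (σ : V → MISState) : ℝ≥0∞ :=
  if Consistent G σ then ENNReal.ofReal (∑ v, nodePotential G σ v) else ⊤

/-- The value `⊤` off consistent states makes the bound trivial there, so the support of the run
need not be tracked. -/
theorem slotExp_iterate_potential_le (r : ℕ) (G : SimpleGraph V) (σ : V → MISState) :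
    (misSlotExp r G)^[r + 2] (potential G) σ ≤
      ENNReal.ofReal √(15 / 16) * potential G σ := by
  by_cases h : Consistent G σ
  · rw [slotExp_iterate_phase r G h.atPhaseStart
      (g := fun b => ∑ v, nodePotential G (afterPhase G σ b) v)
      (fun b => Finset.sum_nonneg fun v _ => nodePotential_nonneg _ _ _)
      (fun b hb => if_pos (h.afterPhase hb)), potential, if_pos h,
      ← ENNReal.ofReal_mul (Real.sqrt_nonneg _), coinExp_sum, Finset.mul_sum]
    exact ENNReal.ofReal_le_ofReal
      (Finset.sum_le_sum fun v _ => coinExp_nodePotential_le G h.atPhaseStart v)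
  · rw [potential, if_neg h, ENNReal.mul_top]
    · exact le_top
    · simp

theorem tsum_run_potential_le (r : ℕ) (G : SimpleGraph V) (t : ℕ) :
    ∑' σ, misRun r G ((r + 2) * t) σ * potential G σ ≤
      ENNReal.ofReal (√(15 / 16) ^ t) * potential G fun _ => .contending 0 := by
  induction t with
  | zero =>
    simp only [Nat.mul_zero, pow_zero, ENNReal.ofReal_one, one_mul]
    exact (PMF.tsum_pure_mul _ _).le
  | succ t ih =>
    rw [Nat.mul_succ, tsum_misRun_add, pow_succ', ENNReal.ofReal_mul (Real.sqrt_nonneg _), mul_assoc]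
    refine le_trans ?_ (mul_le_mul_right ih _)
    rw [← ENNReal.tsum_mul_left]
    refine ENNReal.tsum_le_tsum fun σ => ?_
    rw [mul_left_comm]
    exact mul_le_mul_right (slotExp_iterate_potential_le r G σ) _

theorem one_le_potential {G : SimpleGraph V} {σ : V → MISState} (h : ¬ MISComputed G σ) :
    1 ≤ potential G σ := by
  unfold potential
  split_ifs with hc
  swap
  · exact le_top
  rw [ENNReal.one_le_ofReal]
  obtain ⟨v, hv⟩ : ∃ v, ¬ misHalted (σ v) = true := by
    by_contra! hh
    exact h (hc.misComputed hh)
  refine le_trans ?_ (Finset.single_le_sum (fun v _ => nodePotential_nonneg G σ v)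
    (Finset.mem_univ v))
  cases hs : σ v with
  | contending k =>
    rw [nodePotential, hs, stateFactor]
    have h1 : 1 ≤ √(1 + ∑ u ∈ nbrs G v, beepProbs σ u) := by
      rw [Real.one_le_sqrt]
      linarith [Finset.sum_nonneg fun u (_ : u ∈ nbrs G v) => (beepProbs_mem σ u).1]
    exact one_le_mul_of_one_le_of_one_le (one_le_pow₀ (by norm_num)) h1
  | waiting j k w => exact absurd hs (hc.atPhaseStart v j k w)
  | _ => simp [hs, misHalted] at hv

/-- Every node starts with `√(1 + deg / 2)`, and `1 + n / 2 ≤ n` once `n ≥ 2`. -/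
theorem potential_init_le (G : SimpleGraph V) (hV : 2 ≤ Fintype.card V) :
    potential G (fun _ => .contending 0) ≤
      ENNReal.ofReal (Fintype.card V * √(Fintype.card V)) := by
  rw [potential, if_pos (consistent_init G)]
  refine ENNReal.ofReal_le_ofReal ?_
  rw [← nsmul_eq_mul, ← Finset.card_univ]
  refine Finset.sum_le_card_nsmul _ _ _ fun v _ => ?_
  simp only [nodePotential, stateFactor, pow_zero, one_mul, beepProbs, misBeepProb,
    Finset.sum_const, nsmul_eq_mul]
  refine Real.sqrt_le_sqrt ?_
  have h1 : ((nbrs G v).card : ℝ) ≤ (Finset.univ : Finset V).card := by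
    exact_mod_cast Finset.card_le_univ _
  have h2 : (2 : ℝ) ≤ (Finset.univ : Finset V).card := by exact_mod_cast hV
  have h3 : (((1 / 2 : ℝ≥0) ^ (0 + 1) : ℝ≥0) : ℝ) = 1 / 2 := by simp
  rw [h3]
  linarith

/-- The failure probability decays geometrically with the number of phases. -/
theorem one_sub_le_misProb (r : ℕ) (G : SimpleGraph V) (hV : 2 ≤ Fintype.card V) (t : ℕ) :
    1 - √(15 / 16) ^ t * (Fintype.card V * √(Fintype.card V)) ≤ misProb r G ((r + 2) * t) := by
  set c := √(15 / 16 : ℝ) ^ t * (Fintype.card V * √(Fintype.card V)) with hc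
  have hc0 : 0 ≤ c := by positivity
  set p := misRun r G ((r + 2) * t)
  have hF : ∑' σ, p σ * potential G σ ≤ ENNReal.ofReal c := by
    refine (tsum_run_potential_le r G t).trans ?_
    rw [hc, ENNReal.ofReal_mul (by positivity)]
    exact mul_le_mul_right (potential_init_le G hV) _
  -- Markov's inequality: pointwise, 1 is at most the indicator of success plus the potential.
  have h1 : 1 ≤ p.toOuterMeasure {σ | MISComputed G σ} + ENNReal.ofReal c := by
    refine le_trans ?_ (add_le_add_right hF _)
    rw [← p.tsum_coe, PMF.toOuterMeasure_apply, ← ENNReal.tsum_add]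
    refine ENNReal.tsum_le_tsum fun σ => ?_
    by_cases h : MISComputed G σ
    · rw [Set.indicator_of_mem (by exact h)]
      exact le_self_add
    · rw [Set.indicator_of_notMem (by exact h), zero_add]
      exact le_mul_of_one_le_right' (one_le_potential h)
  have hfin : p.toOuterMeasure {σ | MISComputed G σ} ≠ ⊤ :=
    ne_top_of_le_ne_top ENNReal.one_ne_top (by
      rw [PMF.toOuterMeasure_apply, ← p.tsum_coe]
      exact ENNReal.tsum_le_tsum fun σ => Set.indicator_le_self _ _ _)
  have h2 := ENNReal.toReal_mono (ENNReal.add_ne_top.2 ⟨hfin, ENNReal.ofReal_ne_top⟩) h1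
  rw [ENNReal.toReal_add hfin ENNReal.ofReal_ne_top, ENNReal.toReal_ofReal hc0,
    ENNReal.toReal_one] at h2
  exact sub_le_iff_le_add.2 h2

end Potential

/-! ### The number of phases and the error term -/

/-- The constant 76 works because `(15/16)^38 ≤ 1/8`, which turns `76 log₂ n` phases into `n^(-3)`.
The phase lost to the strict bound costs a factor `1/ρ ≤ 2`. -/
theorem sqrt_pow_mul_le {n t : ℕ} (hn : 2 ≤ n) (ht : 76 * Real.logb 2 n - 1 ≤ t) :
    √(15 / 16 : ℝ) ^ t * (n * √n) ≤ 2 * (n : ℝ) ^ (-(3 / 2) : ℝ) := by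
  have hn0 : (0 : ℝ) < n := by positivity
  set ρ := √(15 / 16 : ℝ) with hρ
  have hρ0 : 0 < ρ := by positivity
  have hρ2 : ρ ^ 2 = 15 / 16 := Real.sq_sqrt (by norm_num)
  have hρ1 : ρ ≤ 1 := by nlinarith
  have hρh : 1 / 2 ≤ ρ := by nlinarith
  have hL : 0 ≤ Real.logb 2 n := Real.logb_nonneg one_lt_two (by exact_mod_cast hn.trans' one_le_two)
  have h76 : ρ ^ (76 : ℕ) ≤ (2 : ℝ) ^ (-3 : ℝ) := by
    rw [show (76 : ℕ) = 2 * 38 from rfl, pow_mul, hρ2, Real.rpow_neg two_pos.le]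
    norm_num
  have h1 : ρ ^ t ≤ 2 * (n : ℝ) ^ (-3 : ℝ) := by
    calc ρ ^ t = ρ ^ (t : ℝ) := (Real.rpow_natCast _ _).symm
      _ ≤ ρ ^ (76 * Real.logb 2 n - 1) := Real.rpow_le_rpow_of_exponent_ge hρ0 hρ1 ht
      _ = (ρ ^ (76 : ℕ)) ^ Real.logb 2 n / ρ := by
          rw [Real.rpow_sub hρ0, Real.rpow_one, Real.rpow_mul hρ0.le]
          norm_cast
      _ ≤ ((2 : ℝ) ^ (-3 : ℝ)) ^ Real.logb 2 n / (1 / 2) := by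
          gcongr
      _ = 2 * (n : ℝ) ^ (-3 : ℝ) := by
          rw [← Real.rpow_mul two_pos.le, mul_comm (-3 : ℝ), Real.rpow_mul two_pos.le,
            Real.rpow_logb two_pos (by norm_num) hn0]
          ring
  calc ρ ^ t * (n * √n) ≤ 2 * (n : ℝ) ^ (-3 : ℝ) * (n * √n) := by gcongr
    _ = 2 * (n : ℝ) ^ (-(3 / 2) : ℝ) := by
        rw [Real.sqrt_eq_rpow, ← Real.rpow_one_add' hn0.le (by norm_num), mul_assoc,
          ← Real.rpow_add hn0]
        norm_num

theorem isLittleO_two_mul_rpow :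
    (fun n : ℕ => 2 * (n : ℝ) ^ (-(3 / 2) : ℝ)) =o[Filter.atTop] fun n : ℕ => (n : ℝ)⁻¹ := by
  refine Asymptotics.isLittleO_of_tendsto' ?_ ?_
  · filter_upwards [Filter.eventually_gt_atTop 0] with n hn h
    simp [hn.ne'] at h
  · have h := ((tendsto_rpow_neg_atTop (y := 1 / 2) (by norm_num)).comp
      tendsto_natCast_atTop_atTop).const_mul (2 : ℝ)
    rw [mul_zero] at h
    refine h.congr' ?_
    filter_upwards [Filter.eventually_gt_atTop 0] with n hn
    have hn' : (0 : ℝ) < n := by exact_mod_cast hn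
    rw [Function.comp_apply, div_inv_eq_mul, mul_assoc, ← Real.rpow_add_one hn'.ne']
    norm_num

theorem exists_phases {n : ℕ} (hn : 2 ≤ n) : ∃ t : ℕ, (t : ℝ) < 76 * Real.logb 2 n ∧
    76 * Real.logb 2 n - 1 ≤ t := by
  have hL : 0 < Real.logb 2 n := Real.logb_pos one_lt_two (by exact_mod_cast hn)
  have hc : 0 < ⌈76 * Real.logb 2 n⌉₊ := Nat.ceil_pos.2 (by positivity)
  -- The ceiling minus one is the largest integer strictly below the bound.
  refine ⟨⌈76 * Real.logb 2 n⌉₊ - 1, Nat.lt_ceil.1 (by omega), ?_⟩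
  rw [Nat.cast_sub (by omega), Nat.cast_one]
  linarith [Nat.le_ceil (76 * Real.logb 2 n)]

theorem mainTheorem1 :
    ∃ ε : ℕ → ℝ, Asymptotics.IsLittleO Filter.atTop ε (fun n : ℕ => (n : ℝ)⁻¹) ∧
      ∀ (V : Type*) [Fintype V] (G : SimpleGraph V), 2 ≤ Fintype.card V →
        (∃ t : ℕ, (t : ℝ) < 76 * Real.logb 2 (Fintype.card V) ∧
          ((2 * t : ℕ) : ℝ) < 152 * Real.logb 2 (Fintype.card V) ∧
          1 - ε (Fintype.card V) ≤ misProb 0 G (2 * t)) ∧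
        (∃ t : ℕ, (t : ℝ) < 76 * Real.logb 2 (Fintype.card V) ∧
          ((3 * t : ℕ) : ℝ) < 228 * Real.logb 2 (Fintype.card V) ∧
          1 - ε (Fintype.card V) ≤ misProb 1 (squareGraph G) (3 * t)) := by
  refine ⟨_, isLittleO_two_mul_rpow, fun V _ G hV => ?_⟩
  obtain ⟨t, ht, ht'⟩ := exists_phases hV
  have hε := sqrt_pow_mul_le hV ht'
  refine ⟨⟨t, ht, ?_, ?_⟩, t, ht, ?_, ?_⟩
  · push_cast
    linarith
  · exact (sub_le_sub_left hε 1).trans (one_sub_le_misProb 0 G hV t)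
  · push_cast
    linarith
  · exact (sub_le_sub_left hε 1).trans (one_sub_le_misProb 1 (squareGraph G) hV t)
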